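/- Let $f:\mathbb R^{n}\times\mathbb R^{p}\to\mathbb R^{n}$ be smooth, let $\mathcal V=L^\infty([0,1],\mathbb R^p)$, and assume that for every $u\in\mathcal V$ and $x\in\mathbb R^n$ the system $\dot x(t)=f(x(t),u(t))$, $x(0)=x$, has a (Carathéodory) solution $t\mapsto\varphi_t(u,x)$ on $[0,1]$; write $\varphi=\varphi_1$. Let $R:\mathbb R^n\to\mathbb R^{m}$ be linear and surjective. Let $x^1,\dots,x^q\in\mathbb R^n$ be pairwise distinct, let $y^1,\dots,y^q\in\mathbb R^m$, and for $x\in\mathbb R^n$, $y\in\mathbb R^m$ set $U(x,y)=\{u\in\mathcal V: R(\varphi(u,x))=y\}$. For $u\in\mathcal V$ and $x\in\mathbb R^n$ put $A(t)=\frac{\partial f}{\partial x}(\varphi_t(u,x),u(t))$ and $B(t)=\frac{\partial f}{\partial u}(\varphi_t(u,x),u(t))$, let $\Phi_{(u,x)}(t,\tau)$ be the state transition matrix of $\dot z=A(t)z$, and set $$\mathcal L_{(u,x)}(v)=\int_0^1\Phi_{(u,x)}(1,\tau)B(\tau)v(\tau)\,d\tau,\qquad \ker(u,x)=\{v\in\mathcal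 V: R(\mathcal L_{(u,x)}(v))=0\}.$$ The tangent space $T_uS$ of a set $S\subseteq\mathcal V$ at $u\in S$ is the set of velocities at $u$ of $C^1$ curves in $S$ through $u$. Assume: 1. (Bracket generation) the vector fields $(a_1,\dots,a_q)\mapsto(f(a_1,c),\dots,f(a_q,c))$, $c\in\mathbb R^p$, are bracket-generating at every $q$-tuple of pairwise distinct points of $\mathbb R^n$; 2. (Linearized controllability) for every $i$ and every $u\in U(x^i,y^i)$ the linear time-varying system $\dot z=A(t)z+B(t)v$ along $t\mapsto\varphi_t(u,x^i)$ is controllable on $[0,1]$ with inputs $v\in\mathcal V$; 3. (Strong memorization of degree $q$) for all pairwise distinct $\tilde x^1,\dots,\tilde x^q\in\mathbb R^n$ and all $\tilde y^1,\dots,\tilde y^q\in\mathbb R^m$, the sets $U_i=U(\tilde x^i,\tilde y^i)$ have a common element and intersect transversally, i.e. $T_uU_i+\bigcap_{l\ne i}T_uU_l=\mathcal V$ for every $u\in\bigcap_l U_l$ and every $i$. Then: (a) for every $i$ and every $u\in U(x^i,y^i)$, the set $U(x^i,y^i)$ is a smooth Banach submanifold of $\mathcal V$ near $u$, and $T_uU(x^i,y^i)=\ker(u,x^i)$;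 (b) for every $j\le q$ and every $u\in\bigcap_{i=1}^jU(x^i,y^i)$, the set $\bigcap_{i=1}^jU(x^i,y^i)$ is a smooth Banach submanifold of $\mathcal V$ near $u$, and $$T_u\Big(\bigcap_{i=1}^jU(x^i,y^i)\Big)=\bigcap_{i=1}^j\ker(u,x^i)=:\ker(u,\mathcal X^j),\qquad \mathcal X^j=\{x^1,\dots,x^j\}.$$ -/

import Mathlib

open MeasureTheory Set Filter Topology
open scoped ContDiff ENNReal

noncomputable section

namespace NeuralODE

/-- Euclidean space `ℝ^n`. -/
abbrev Eu (n : ℕ) : Type := EuclideanSpace ℝ (Fin n)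

/-- The Banach space of controls `L^∞([0,1], ℝ^p)`. -/
abbrev Control (p : ℕ) : Type := Lp (Eu p) ∞ ((volume : Measure ℝ).restrict (Icc (0 : ℝ) 1))

/-! ### Trajectories, flow and end-point sets -/

/-- `ξ` is a (Carathéodory) solution on `[0,1]` of `ẋ(t) = f(x(t), u(t))`, `x(0) = x₀`. -/
def IsTrajectory {n p : ℕ} (f : Eu n → Eu p → Eu n) (u : Control p) (x₀ : Eu n)
    (ξ : ℝ → Eu n) : Prop :=
  ContinuousOn ξ (Icc 0 1) ∧
    ∀ t ∈ Icc (0 : ℝ) 1, ξ t = x₀ + ∫ s in (0 : ℝ)..t, f (ξ s) (u s)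

/-- Every control and every initial state admit a solution on the whole of `[0,1]`,
so that the flow is defined on `L^∞([0,1], ℝ^p) × ℝ^n`. -/
def HasFlow {n p : ℕ} (f : Eu n → Eu p → Eu n) : Prop :=
  ∀ (u : Control p) (x₀ : Eu n), ∃ ξ, IsTrajectory f u x₀ ξ

/-- The flow `φ_t(u, x₀)`: the value at time `t ∈ [0,1]` of the solution
(unique on `[0,1]` for smooth `f`) with control `u` and initial state `x₀`. -/
def flow {n p : ℕ} (f : Eu n → Eu p → Eu n) (u : Control p) (x₀ : Eu n) : ℝ → Eu n :=
  Classical.epsilon fun ξ => IsTrajectory f u x₀ ξ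

/-- `U(x, y)`: the controls that steer `x`, at time `1`, into `R⁻¹(y)`. -/
def controlSet {n p m : ℕ} (f : Eu n → Eu p → Eu n) (R : Eu n →L[ℝ] Eu m)
    (x : Eu n) (y : Eu m) : Set (Control p) :=
  {u | R (flow f u x 1) = y}

/-! ### Linearization along a trajectory -/

/-- `A(t) = ∂f/∂x` at `(φ_t(u, x), u(t))`. -/
def linA {n p : ℕ} (f : Eu n → Eu p → Eu n) (u : Control p) (x : Eu n) (t : ℝ) :
    Eu n →L[ℝ] Eu n :=
  fderiv ℝ (fun a => f a (u t)) (flow f u x t)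

/-- `B(t) = ∂f/∂u` at `(φ_t(u, x), u(t))`. -/
def linB {n p : ℕ} (f : Eu n → Eu p → Eu n) (u : Control p) (x : Eu n) (t : ℝ) :
    Eu p →L[ℝ] Eu n :=
  fderiv ℝ (fun c => f (flow f u x t) c) (u t)

/-- `z` solves `ż = A z + B v`, `z(0) = z₀`, on `[0,1]`. -/
def IsLinTrajectory {n p : ℕ} (f : Eu n → Eu p → Eu n) (u : Control p) (x : Eu n)
    (v : Control p) (z₀ : Eu n) (z : ℝ → Eu n) : Prop :=
  ContinuousOn z (Icc 0 1) ∧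
    ∀ t ∈ Icc (0 : ℝ) 1,
      z t = z₀ + ∫ s in (0 : ℝ)..t, (linA f u x s (z s) + linB f u x s (v s))

/-- The linear time-varying system `ż = A z + B v` is controllable on `[0,1]`. -/
def LinControllable {n p : ℕ} (f : Eu n → Eu p → Eu n) (u : Control p) (x : Eu n) : Prop :=
  ∀ z₀ z₁ : Eu n, ∃ (v : Control p) (z : ℝ → Eu n), IsLinTrajectory f u x v z₀ z ∧ z 1 = z₁

/-- Linearized controllability property at `x` (with target `y`). -/
def LCP {n p m : ℕ} (f : Eu n → Eu p → Eu n) (R : Eu n →L[ℝ] Eu m)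
    (x : Eu n) (y : Eu m) : Prop :=
  ∀ u ∈ controlSet f R x y, LinControllable f u x

/-- `Ψ = Φ(·, τ)` solves `∂ₜ Φ(t, τ) = A(t) Φ(t, τ)`, `Φ(τ, τ) = 1`, on `[0,1]`. -/
def IsTransition {n p : ℕ} (f : Eu n → Eu p → Eu n) (u : Control p) (x : Eu n) (τ : ℝ)
    (Ψ : ℝ → Eu n →L[ℝ] Eu n) : Prop :=
  ContinuousOn Ψ (Icc 0 1) ∧
    ∀ t ∈ Icc (0 : ℝ) 1,
      Ψ t = ContinuousLinearMap.id ℝ (Eu n) + ∫ s in τ..t, (linA f u x s).comp (Ψ s)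

/-- The state transition matrix `Φ_{(u,x)}(t, τ)`, for `t, τ ∈ [0,1]`. -/
def transition {n p : ℕ} (f : Eu n → Eu p → Eu n) (u : Control p) (x : Eu n) (t τ : ℝ) :
    Eu n →L[ℝ] Eu n :=
  Classical.epsilon (fun Ψ => IsTransition f u x τ Ψ) t

/-- The linearized end-point operator
`L_{(u,x)}(v) = ∫₀¹ Φ_{(u,x)}(1, τ) B(τ) v(τ) dτ`. -/
def linEndpoint {n p : ℕ} (f : Eu n → Eu p → Eu n) (u : Control p) (x : Eu n)
    (v : Control p) : Eu n :=
  ∫ τ in (0 : ℝ)..1, transition f u x 1 τ (linB f u x τ (v τ))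

/-- `ker(u, x)`: the kernel of `v ↦ R(L_{(u,x)}(v))`. -/
def linKer {n p m : ℕ} (f : Eu n → Eu p → Eu n) (R : Eu n →L[ℝ] Eu m)
    (u : Control p) (x : Eu n) : Set (Control p) :=
  {v | R (linEndpoint f u x v) = 0}

/-! ### Submanifolds, tangent spaces and transversality in a Banach space -/

section Banach

variable {X : Type*} [NormedAddCommGroup X] [NormedSpace ℝ X]

/-- `S` is a smooth Banach submanifold near `u`: some smooth local chart of `X` around `u`
straightens `S` to a closed complemented subspace. -/
def IsSubmanifoldAt (S : Set X) (u : X) : Prop :=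
  ∃ (T : Submodule ℝ X) (χ : OpenPartialHomeomorph X X),
    T.ClosedComplemented ∧ u ∈ χ.source ∧
    ContDiffOn ℝ ∞ χ χ.source ∧ ContDiffOn ℝ ∞ χ.symm χ.target ∧
    ∀ w ∈ χ.source, w ∈ S ↔ χ w ∈ T

/-- The tangent space at `u` of a subset `S` of a Banach space: the velocities at `u` of the
`C¹` curves in `S` through `u`. -/
def tangentAt (S : Set X) (u : X) : Set X :=
  {v | ∃ γ : ℝ → X, γ 0 = u ∧ ContDiffAt ℝ 1 γ 0 ∧ HasDerivAt γ v 0 ∧ ∀ᶠ t in 𝓝 (0 : ℝ), γ t ∈ S}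

/-- The members of a finite family `M` intersect transversally: at each common point, the tangent
space of each member and the intersection of the tangent spaces of all the others
together span the whole space. For two sets this is `T_u M₁ + T_u M₂ = X`. -/
def IntersectTransversally {q : ℕ} (M : Fin q → Set X) : Prop :=
  ∀ u ∈ ⋂ i, M i, ∀ i : Fin q, ∀ w : X,
    ∃ a ∈ tangentAt (M i) u, ∃ b ∈ ⋂ l ∈ {l : Fin q | l ≠ i}, tangentAt (M l) u, a + b = w

/-! ### Bracket-generating families -/

/-- Iterated Lie brackets of members of a family of vector fields. -/
inductive IsIteratedBracket (F : Set (X → X)) : (X → X) → Prop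
  | base (V : X → X) (hV : V ∈ F) : IsIteratedBracket F V
  | bracket (V W : X → X) (hV : IsIteratedBracket F V) (hW : IsIteratedBracket F W) :
      IsIteratedBracket F (VectorField.lieBracket ℝ V W)

/-- At each point of `s`, the Lie algebra generated by `F` evaluates to the full tangent space. -/
def IsBracketGeneratingOn (F : Set (X → X)) (s : Set X) : Prop :=
  ∀ a ∈ s, Submodule.span ℝ {v : X | ∃ W, IsIteratedBracket F W ∧ W a = v} = ⊤

end Banach

/-- The control vector fields `(f(·, c), …, f(·, c))`, `c ∈ ℝ^p`, of the `q`-folded system. -/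
def foldedFields {n p : ℕ} (f : Eu n → Eu p → Eu n) (q : ℕ) :
    Set ((Fin q → Eu n) → (Fin q → Eu n)) :=
  Set.range fun (c : Eu p) (a : Fin q → Eu n) (i : Fin q) => f (a i) c

/-- The `q`-folded system is bracket-generating on the `q`-tuples of distinct points. -/
def FoldedBracketGenerating {n p : ℕ} (f : Eu n → Eu p → Eu n) (q : ℕ) : Prop :=
  IsBracketGeneratingOn (foldedFields f q) {a : Fin q → Eu n | Function.Injective a}

/-- Strong memorization property of degree `q`: for all distinct points `x^1, …, x^q` and
all targets `y^1, …, y^q`, the sets `U(x^i, y^i)` have a common element and intersect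
transversally. -/
def StrongMemorization {n p m : ℕ} (f : Eu n → Eu p → Eu n) (R : Eu n →L[ℝ] Eu m)
    (q : ℕ) : Prop :=
  ∀ (x : Fin q → Eu n) (y : Fin q → Eu m), Function.Injective x →
    (⋂ i, controlSet f R (x i) (y i)).Nonempty ∧
      IntersectTransversally fun i => controlSet f R (x i) (y i)

end NeuralODE

end

namespace NeuralODE

/-! ### Superposition operators on `L^∞`. -/

section Nemytskii

universe w

variable {α : Type*} [MeasurableSpace α] {μ : Measure α}

/-! The sets in question are level sets of output maps `u ↦ R (φ(u, x))`, so everything reduces to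
showing that these maps are smooth on `L^∞`, with derivative `R ∘ L_{(u,x)}`, and that they, or
finite products of them, are submersions.

Smoothness: a trajectory is a zero in `L^∞` of `ξ - (x + V(f(ξ, u)))`, with `V` the Volterra
operator. Superposition is smooth on `L^∞` (`contDiff_nemytskii`), and the partial derivative in `ξ`
is `1 - V A`, invertible because the powers of `V A` decay factorially
(`isUnit_one_sub_volterraMul`). The implicit function theorem, with uniqueness of solutions
(`solution_unique`), makes `u ↦ ξ` smooth. Its derivative solves the variational equation, and
variation of constants (`primitiveL_eq_linEndpoint`) turns the value at time 1 into `L_{(u,x)}`.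

Submersion: for one point, linearized controllability makes `L_{(u,x)}` onto, and `R` is onto. For
several points, transversality is applied to the sets through `u` whose targets are the actual
outputs of `u`. Writing a control as `a + b`, with `a` tangent to the `i`-th set and `b` tangent to
all the others, gives a `b` that moves only the `i`-th output (`exists_separating_variation`); sums
of such `b` reach every joint value. The level set of a submersion onto a finite-dimensional space
is a submanifold tangent to the kernel (`exists_chart_levelSet`). -/

theorem Linfty.ae_norm_le {E : Type*} [NormedAddCommGroup E] (u : Lp E ∞ μ) :
    ∀ᵐ t ∂μ, ‖u t‖ ≤ ‖u‖ := by
  have h := ae_le_eLpNormEssSup (f := u) (μ := μ)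
  filter_upwards [h] with t ht
  rw [← eLpNorm_exponent_top] at ht
  rw [Lp.norm_def, ← toReal_enorm]
  exact ENNReal.toReal_mono (Lp.eLpNorm_ne_top u) ht

theorem Linfty.norm_le {E : Type*} [NormedAddCommGroup E] {u : Lp E ∞ μ}
    {C : ℝ} (hC : 0 ≤ C) (h : ∀ᵐ t ∂μ, ‖u t‖ ≤ C) : ‖u‖ ≤ C := by
  rw [Lp.norm_def, eLpNorm_exponent_top]
  exact ENNReal.toReal_le_of_le_ofReal hC (eLpNormEssSup_le_of_ae_bound h)

variable {E : Type*} [NormedAddCommGroup E] [NormedSpace ℝ E] [FiniteDimensional ℝ E]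

theorem memLp_top_comp {F : Type*} [NormedAddCommGroup F] {g : E → F} (hg : Continuous g)
    (u : Lp E ∞ μ) : MemLp (fun t => g (u t)) ∞ μ := by
  have := FiniteDimensional.proper ℝ E
  obtain ⟨C, hC⟩ := (isCompact_closedBall (0 : E) ‖u‖).exists_bound_of_continuousOn hg.continuousOn
  refine memLp_top_of_bound (hg.comp_aestronglyMeasurable (Lp.aestronglyMeasurable u)) C ?_
  filter_upwards [Linfty.ae_norm_le u] with t ht
  exact hC _ (by simpa using ht)

/-- The superposition (Nemytskii) operator `u ↦ g ∘ u` on `L^∞`. -/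
noncomputable def nemytskii {F : Type*} [NormedAddCommGroup F] (g : E → F) (hg : Continuous g)
    (u : Lp E ∞ μ) : Lp F ∞ μ :=
  (memLp_top_comp hg u).toLp

theorem coeFn_nemytskii {F : Type*} [NormedAddCommGroup F] {g : E → F} (hg : Continuous g)
    (u : Lp E ∞ μ) : nemytskii g hg u =ᵐ[μ] fun t => g (u t) :=
  MemLp.coeFn_toLp _

/-- Pointwise application of operator-valued to vector-valued `L^∞` functions. -/
noncomputable def applyL (μ : Measure α) (E F : Type*) [NormedAddCommGroup E] [NormedSpace ℝ E]
    [NormedAddCommGroup F] [NormedSpace ℝ F] :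
    Lp (E →L[ℝ] F) ∞ μ →L[ℝ] Lp E ∞ μ →L[ℝ] Lp F ∞ μ :=
  (ContinuousLinearMap.id ℝ (E →L[ℝ] F)).holderL μ ∞ ∞ ∞

theorem coeFn_applyL {E F : Type*} [NormedAddCommGroup E] [NormedSpace ℝ E]
    [NormedAddCommGroup F] [NormedSpace ℝ F] (A : Lp (E →L[ℝ] F) ∞ μ) (h : Lp E ∞ μ) :
    applyL μ E F A h =ᵐ[μ] fun t => A t (h t) :=
  ContinuousLinearMap.coeFn_holder (ContinuousLinearMap.id ℝ (E →L[ℝ] F)) A h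

/-- The mean value inequality holds pointwise with one constant for almost all `t`, because `u` is
essentially bounded and `fderiv ℝ g` is uniformly continuous on balls. This is where `L^∞`, rather
than another `L^p`, matters. -/
theorem hasFDerivAt_nemytskii {F : Type*} [NormedAddCommGroup F] [NormedSpace ℝ F]
    {g : E → F} (hg : ContDiff ℝ 1 g) (u : Lp E ∞ μ) :
    HasFDerivAt (nemytskii (μ := μ) g hg.continuous)
      (applyL μ E F (nemytskii (fderiv ℝ g) (hg.continuous_fderiv one_ne_zero) u)) u := by
  have := FiniteDimensional.proper ℝ E
  rw [hasFDerivAt_iff_isLittleO_nhds_zero, Asymptotics.isLittleO_iff]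
  intro ε hε
  have huc := (isCompact_closedBall (0 : E) (‖u‖ + 1)).uniformContinuousOn_of_continuous
    (hg.continuous_fderiv one_ne_zero).continuousOn
  obtain ⟨δ, hδ, hδ'⟩ := Metric.uniformContinuousOn_iff.1 huc ε hε
  -- The bound 1 keeps `u t + h t` in the ball of radius `‖u‖ + 1`; the bound `δ` makes the
  -- derivative vary by less than `ε`.
  have hpos : 0 < min δ 1 := lt_min hδ one_pos
  filter_upwards [Metric.ball_mem_nhds (0 : Lp E ∞ μ) hpos] with h hh
  rw [mem_ball_zero_iff] at hh
  refine Linfty.norm_le (by positivity) ?_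
  filter_upwards [Linfty.ae_norm_le u, Linfty.ae_norm_le h, Lp.coeFn_add u h,
    coeFn_nemytskii hg.continuous (u + h), coeFn_nemytskii hg.continuous u,
    coeFn_nemytskii (hg.continuous_fderiv one_ne_zero) u,
    coeFn_applyL (nemytskii (fderiv ℝ g) (hg.continuous_fderiv one_ne_zero) u) h,
    Lp.coeFn_sub (nemytskii g hg.continuous (u + h) - nemytskii g hg.continuous u)
      (applyL μ E F (nemytskii (fderiv ℝ g) (hg.continuous_fderiv one_ne_zero) u) h),
    Lp.coeFn_sub (nemytskii g hg.continuous (u + h)) (nemytskii g hg.continuous u)]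
    with t h1 h2 h3 h4 h5 h6 h7 h8 h9
  rw [h8, Pi.sub_apply, h9, Pi.sub_apply, h4, h5, h7, h6, h3, Pi.add_apply]
  have key : ∀ z ∈ Metric.closedBall (u t) ‖h t‖, ‖fderiv ℝ g z - fderiv ℝ g (u t)‖ ≤ ε := by
    intro z hz
    rw [mem_closedBall_iff_norm] at hz
    have hz1 : ‖z - u t‖ < min δ 1 := (hz.trans h2).trans_lt hh
    rw [← dist_eq_norm]
    refine (hδ' z ?_ (u t) ?_ ?_).le
    · rw [mem_closedBall_zero_iff]
      have := norm_add_le (z - u t) (u t)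
      rw [sub_add_cancel] at this
      linarith [hz1.trans_le (min_le_right δ 1)]
    · rw [mem_closedBall_zero_iff]; linarith
    · rw [dist_eq_norm]; exact hz1.trans_le (min_le_left _ _)
  have := (convex_closedBall (u t) ‖h t‖).norm_image_sub_le_of_norm_hasFDerivWithin_le'
    (f := g) (f' := fderiv ℝ g) (φ := fderiv ℝ g (u t)) (C := ε) (x := u t) (y := u t + h t)
    (fun z _ => ((hg.differentiable one_ne_zero) z).hasFDerivAt.hasFDerivWithinAt) key
    (by simp) (by simp)
  rw [add_sub_cancel_left] at this
  exact this.trans (by gcongr)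

/-- The derivative is again a superposition operator, that of `fderiv ℝ g`, followed by a bounded
linear map, so induction on the order works with `F` varying. `E` and `F` share a universe so that
`E →L[ℝ] F` stays in it. -/
theorem contDiff_nemytskii {E F : Type w} [NormedAddCommGroup E] [NormedSpace ℝ E]
    [FiniteDimensional ℝ E] [NormedAddCommGroup F] [NormedSpace ℝ F]
    {g : E → F} (hg : ContDiff ℝ ∞ g) :
    ContDiff ℝ ∞ (nemytskii (μ := μ) g hg.continuous) := by
  rw [contDiff_infty]
  intro k
  induction k generalizing F with
  | zero =>
    rw [Nat.cast_zero, contDiff_zero, continuous_iff_continuousAt]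
    exact fun u => (hasFDerivAt_nemytskii (hg.of_le (by simp)) u).continuousAt
  | succ k ih =>
    have hg' : ContDiff ℝ ∞ (fderiv ℝ g) := (contDiff_infty_iff_fderiv.1 hg).2
    rw [Nat.cast_succ, contDiff_succ_iff_hasFDerivAt]
    exact ⟨fun u => applyL μ E F (nemytskii (fderiv ℝ g) hg'.continuous u),
      (applyL μ E F).contDiff.comp (ih hg'),
      fun u => hasFDerivAt_nemytskii (hg.of_le (by simp)) u⟩

end Nemytskii

/-! ### Primitives and Volterra operators on `[0,1]`. -/

section Volterra

/-- Lebesgue measure on the unit interval. -/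
noncomputable abbrev unitMeasure : Measure ℝ := volume.restrict (Icc (0 : ℝ) 1)

variable {F : Type*} [NormedAddCommGroup F] [NormedSpace ℝ F]

theorem unitMeasure_real_univ : unitMeasure.real univ = 1 := by
  simp [unitMeasure, measureReal_def]

theorem Linfty.integrable {F : Type*} [NormedAddCommGroup F] (w : Lp F ∞ unitMeasure) : Integrable w unitMeasure :=
  (Lp.memLp w).integrable le_top

theorem intervalIntegral_unitMeasure {a b : ℝ} (ha : a ∈ Icc (0 : ℝ) 1) (hb : b ∈ Icc (0 : ℝ) 1)
    (g : ℝ → F) : ∫ s in a..b, g s ∂unitMeasure = ∫ s in a..b, g s := by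
  rw [intervalIntegral, intervalIntegral, Measure.restrict_restrict measurableSet_Ioc,
    Measure.restrict_restrict measurableSet_Ioc,
    inter_eq_left.2 (Ioc_subset_Icc_self.trans (Icc_subset_Icc ha.1 hb.2)),
    inter_eq_left.2 (Ioc_subset_Icc_self.trans (Icc_subset_Icc hb.1 ha.2))]

theorem intervalIntegral_indicator_unit (a b : ℝ) (g : ℝ → F) :
    ∫ s in a..b, g s ∂unitMeasure = ∫ s in a..b, (Icc (0 : ℝ) 1).indicator g s := by
  rw [intervalIntegral, intervalIntegral, Measure.restrict_restrict measurableSet_Ioc,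
    Measure.restrict_restrict measurableSet_Ioc, setIntegral_indicator measurableSet_Icc,
    setIntegral_indicator measurableSet_Icc]

/-- The value at time `t` of the primitive, vanishing at `0`, of an `L^∞` function. -/
noncomputable def primitiveL (F : Type*) [NormedAddCommGroup F] [NormedSpace ℝ F] (t : ℝ) :
    Lp F ∞ unitMeasure →L[ℝ] F :=
  LinearMap.mkContinuous
    { toFun := fun w => ∫ s in (0 : ℝ)..t, w s ∂unitMeasure
      map_add' := fun v w => by
        rw [← intervalIntegral.integral_add (Linfty.integrable v).intervalIntegrable
          (Linfty.integrable w).intervalIntegrable]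
        exact intervalIntegral.integral_congr_ae ((Lp.coeFn_add v w).mono fun s hs _ => hs)
      map_smul' := fun c w => by
        rw [RingHom.id_apply, ← intervalIntegral.integral_smul]
        exact intervalIntegral.integral_congr_ae ((Lp.coeFn_smul c w).mono fun s hs _ => hs) }
    1 fun w => by
      refine intervalIntegral.norm_integral_le_integral_norm_uIoc.trans ?_
      refine (setIntegral_le_integral (Linfty.integrable w).norm
        (Eventually.of_forall fun _ => norm_nonneg _)).trans ?_
      refine (integral_mono_ae (Linfty.integrable w).norm (integrable_const ‖w‖)
        (Linfty.ae_norm_le w)).trans ?_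
      rw [integral_const, unitMeasure_real_univ, one_smul, one_mul]

theorem primitiveL_apply (t : ℝ) (w : Lp F ∞ unitMeasure) :
    primitiveL F t w = ∫ s in (0 : ℝ)..t, w s ∂unitMeasure := rfl

theorem primitiveL_eq {t : ℝ} (ht : t ∈ Icc (0 : ℝ) 1) {w : Lp F ∞ unitMeasure} {g : ℝ → F}
    (h : w =ᵐ[unitMeasure] g) : primitiveL F t w = ∫ s in (0 : ℝ)..t, g s := by
  rw [primitiveL_apply, ← intervalIntegral_unitMeasure (by simp) ht]
  exact intervalIntegral.integral_congr_ae (h.mono fun s hs _ => hs)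

theorem primitiveL_zero (w : Lp F ∞ unitMeasure) : primitiveL F 0 w = 0 := by
  rw [primitiveL_apply, intervalIntegral.integral_same]

theorem norm_primitiveL_le (t : ℝ) (w : Lp F ∞ unitMeasure) : ‖primitiveL F t w‖ ≤ ‖w‖ := by
  have := (LinearMap.mkContinuous_norm_le _ zero_le_one _ : ‖primitiveL F t‖ ≤ 1)
  simpa using (primitiveL F t).le_of_opNorm_le this w

/-- The restricted measure extends the integrand by zero, so the Lipschitz bound needs no condition
on `t` and `s`. -/
theorem norm_primitiveL_sub_le (t s : ℝ) (w : Lp F ∞ unitMeasure) :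
    ‖primitiveL F t w - primitiveL F s w‖ ≤ ‖w‖ * |t - s| := by
  rw [primitiveL_apply, primitiveL_apply, intervalIntegral.integral_interval_sub_left
    (Linfty.integrable w).intervalIntegrable (Linfty.integrable w).intervalIntegrable,
    intervalIntegral_indicator_unit]
  refine intervalIntegral.norm_integral_le_of_norm_le_const_ae ?_
  have := (ae_restrict_iff' measurableSet_Icc).1 (Linfty.ae_norm_le w)
  filter_upwards [this] with r hr _
  by_cases h : r ∈ Icc (0 : ℝ) 1
  · rw [indicator_of_mem h]; exact hr h
  · rw [indicator_of_notMem h, norm_zero]; exact norm_nonneg w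

theorem continuous_primitiveL (w : Lp F ∞ unitMeasure) :
    Continuous fun t => primitiveL F t w := by
  refine (LipschitzWith.of_dist_le_mul (K := ‖w‖₊) fun t s => ?_).continuous
  rw [dist_eq_norm, Real.dist_eq]
  exact norm_primitiveL_sub_le t s w

theorem ae_hasDerivAt_primitiveL [CompleteSpace F] (w : Lp F ∞ unitMeasure) :
    ∀ᵐ t, t ∈ Icc (0 : ℝ) 1 → HasDerivAt (fun t => primitiveL F t w) (w t) t := by
  have hi : Integrable ((Icc (0 : ℝ) 1).indicator w) :=
    (integrable_indicator_iff measurableSet_Icc).2 (Linfty.integrable w)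
  filter_upwards [LocallyIntegrable.ae_hasDerivAt_integral hi.locallyIntegrable] with t ht h
  have := ht 0
  rw [indicator_of_mem h] at this
  simpa only [primitiveL_apply, intervalIntegral_indicator_unit] using this

theorem memLp_primitiveL (w : Lp F ∞ unitMeasure) :
    MemLp (fun t => primitiveL F t w) ∞ unitMeasure :=
  memLp_top_of_bound (continuous_primitiveL w).aestronglyMeasurable ‖w‖
    (Eventually.of_forall fun t => norm_primitiveL_le t w)

/-- The Volterra operator `w ↦ ∫₀ᵗ w` on `L^∞`. -/
noncomputable def volterra (F : Type*) [NormedAddCommGroup F] [NormedSpace ℝ F] :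
    Lp F ∞ unitMeasure →L[ℝ] Lp F ∞ unitMeasure :=
  LinearMap.mkContinuous
    { toFun := fun w => (memLp_primitiveL w).toLp
      map_add' := fun v w => by
        rw [← MemLp.toLp_add]
        exact MemLp.toLp_congr _ _ (Eventually.of_forall fun t => map_add (primitiveL F t) v w)
      map_smul' := fun c w => by
        rw [RingHom.id_apply, ← MemLp.toLp_const_smul]
        exact MemLp.toLp_congr _ _ (Eventually.of_forall fun t => map_smul (primitiveL F t) c w) }
    1 fun w => by
      rw [one_mul]
      refine Linfty.norm_le (norm_nonneg w) ?_
      filter_upwards [(memLp_primitiveL w).coeFn_toLp] with t ht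
      exact ht ▸ norm_primitiveL_le t w

theorem coeFn_volterra (w : Lp F ∞ unitMeasure) :
    volterra F w =ᵐ[unitMeasure] fun t => primitiveL F t w :=
  (memLp_primitiveL w).coeFn_toLp

/-- The Volterra operator `w ↦ ∫₀ᵗ A w`. -/
noncomputable def volterraMul (A : Lp (F →L[ℝ] F) ∞ unitMeasure) :
    Lp F ∞ unitMeasure →L[ℝ] Lp F ∞ unitMeasure :=
  (volterra F).comp (applyL unitMeasure F F A)

/-- Picard iteration: each integration of `s ^ k` yields `t ^ (k + 1) / (k + 1)`, whence the
factorial. -/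
theorem norm_volterraMul_pow_le (A : Lp (F →L[ℝ] F) ∞ unitMeasure) (w : Lp F ∞ unitMeasure)
    (k : ℕ) : ∀ᵐ t ∂unitMeasure,
      ‖(volterraMul A ^ k) w t‖ ≤ ‖A‖ ^ k / (k.factorial : ℝ) * ‖w‖ * t ^ k := by
  induction k with
  | zero => simpa using Linfty.ae_norm_le w
  | succ k ih =>
    have hmem : ∀ᵐ t ∂unitMeasure, t ∈ Icc (0 : ℝ) 1 := ae_restrict_mem measurableSet_Icc
    set z := (volterraMul A ^ k) w with hz
    have hsucc : (volterraMul A ^ (k + 1)) w = volterra F (applyL unitMeasure F F A z) := by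
      rw [pow_succ']; rfl
    rw [hsucc]
    have hb : ∀ᵐ s ∂unitMeasure, ‖A s (z s)‖ ≤
        ‖A‖ * (‖A‖ ^ k / (k.factorial : ℝ) * ‖w‖) * s ^ k := by
      filter_upwards [ih, Linfty.ae_norm_le A] with s h1 h2
      calc ‖A s (z s)‖ ≤ ‖A s‖ * ‖z s‖ := (A s).le_opNorm _
        _ ≤ ‖A‖ * (‖A‖ ^ k / (k.factorial : ℝ) * ‖w‖ * s ^ k) := by gcongr
        _ = _ := by ring
    filter_upwards [coeFn_volterra (applyL unitMeasure F F A z), hmem] with t ht h01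
    rw [ht, primitiveL_eq h01 (coeFn_applyL A z)]
    refine (intervalIntegral.norm_integral_le_of_norm_le
      (g := fun s => ‖A‖ * (‖A‖ ^ k / (k.factorial : ℝ) * ‖w‖) * s ^ k) h01.1 ?_
      (Continuous.intervalIntegrable (by fun_prop) 0 t)).trans (le_of_eq ?_)
    · filter_upwards [(ae_restrict_iff' measurableSet_Icc).1 hb] with s hs hs'
      exact hs ⟨hs'.1.le, hs'.2.trans h01.2⟩
    · rw [intervalIntegral.integral_const_mul, integral_pow, Nat.factorial_succ]
      push_cast
      field_simp
      ring

/-- Some power of the operator has norm below 1 however large `‖A‖` is, and `1 - T` divides `1 - T ^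
k`. -/
theorem isUnit_one_sub_volterraMul (A : Lp (F →L[ℝ] F) ∞ unitMeasure) [CompleteSpace F] :
    IsUnit (1 - volterraMul A) := by
  have hb : ∀ k : ℕ, ‖volterraMul A ^ k‖ ≤ ‖A‖ ^ k / (k.factorial : ℝ) := by
    intro k
    refine ContinuousLinearMap.opNorm_le_bound _ (by positivity) fun w => ?_
    refine Linfty.norm_le (by positivity) ?_
    filter_upwards [norm_volterraMul_pow_le A w k, ae_restrict_mem measurableSet_Icc] with t ht h01
    refine ht.trans (mul_le_of_le_one_right (by positivity) (pow_le_one₀ h01.1 h01.2))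
  have hlim := FloorSemiring.tendsto_pow_div_factorial_atTop ‖A‖
  obtain ⟨k, hk⟩ := (hlim.eventually_lt_const one_pos).exists
  have hu : IsUnit (1 - volterraMul A ^ k) := isUnit_one_sub_of_norm_lt_one ((hb k).trans_lt hk)
  have hfac : (1 - volterraMul A) * (∑ i ∈ Finset.range k, volterraMul A ^ i)
      = 1 - volterraMul A ^ k := mul_neg_geom_sum _ _
  have hcomm : Commute (1 - volterraMul A) (∑ i ∈ Finset.range k, volterraMul A ^ i) :=
    Commute.sum_right _ _ _ fun i _ =>
      (((Commute.one_left _).sub_left (Commute.refl _)).pow_right i : _)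
  rw [← hfac] at hu
  exact (hcomm.isUnit_mul_iff.1 hu).1

end Volterra

/-! ### Product rule for Lipschitz primitives. -/

section ProductRule

variable {E F G : Type*} [NormedAddCommGroup E] [NormedSpace ℝ E] [CompleteSpace E]
  [NormedAddCommGroup F] [NormedSpace ℝ F] [CompleteSpace F]
  [NormedAddCommGroup G] [NormedSpace ℝ G] [CompleteSpace G]

/-- The product rule for primitives of `L^∞` functions. -/
theorem bilin_primitiveL (B : E →L[ℝ] F →L[ℝ] G) (p : Lp E ∞ unitMeasure)
    (w : Lp F ∞ unitMeasure) (a : E) (b : F) (k : Lp G ∞ unitMeasure)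
    (hk : k =ᵐ[unitMeasure] fun s =>
      B (p s) (b + primitiveL F s w) + B (a + primitiveL E s p) (w s))
    {t : ℝ} (ht : t ∈ Icc (0 : ℝ) 1) :
    B (a + primitiveL E t p) (b + primitiveL F t w) = B a b + primitiveL G t k := by
  -- The difference of the two sides is Lipschitz, hence absolutely continuous, and its derivative
  -- vanishes almost everywhere on `[0,1]`; so it is constant there.
  set h : ℝ → G := fun t => B (a + primitiveL E t p) (b + primitiveL F t w) - primitiveL G t k
    with hh
  have hP : ∀ t, ‖a + primitiveL E t p‖ ≤ ‖a‖ + ‖p‖ := fun t =>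
    (norm_add_le _ _).trans (by gcongr; exact norm_primitiveL_le t p)
  have hQ : ∀ t, ‖b + primitiveL F t w‖ ≤ ‖b‖ + ‖w‖ := fun t =>
    (norm_add_le _ _).trans (by gcongr; exact norm_primitiveL_le t w)
  set K : ℝ := ‖B‖ * ((‖a‖ + ‖p‖) * ‖w‖) + ‖B‖ * (‖p‖ * (‖b‖ + ‖w‖)) + ‖k‖ with hK
  have hK0 : 0 ≤ K := by positivity
  have hlip : LipschitzWith ⟨K, hK0⟩ h := by
    refine LipschitzWith.of_dist_le_mul fun t s => ?_
    have e : h t - h s = B (a + primitiveL E t p) (primitiveL F t w - primitiveL F s w)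
        + B (primitiveL E t p - primitiveL E s p) (b + primitiveL F s w)
        - (primitiveL G t k - primitiveL G s k) := by
      simp only [hh, map_add, map_sub, add_apply,
        sub_apply]
      abel
    rw [dist_eq_norm, Real.dist_eq, e]
    change _ ≤ K * |t - s|
    refine (norm_sub_le _ _).trans ?_
    rw [hK, add_mul]
    refine add_le_add ((norm_add_le _ _).trans ?_) (norm_primitiveL_sub_le t s k)
    rw [add_mul]
    refine add_le_add ((B.le_opNorm₂ _ _).trans ?_) ((B.le_opNorm₂ _ _).trans ?_)
    · calc ‖B‖ * ‖a + primitiveL E t p‖ * ‖primitiveL F t w - primitiveL F s w‖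
          ≤ ‖B‖ * (‖a‖ + ‖p‖) * (‖w‖ * |t - s|) := by
            gcongr
            · exact hP t
            · exact norm_primitiveL_sub_le t s w
        _ = _ := by ring
    · calc ‖B‖ * ‖primitiveL E t p - primitiveL E s p‖ * ‖b + primitiveL F s w‖
          ≤ ‖B‖ * (‖p‖ * |t - s|) * (‖b‖ + ‖w‖) := by
            gcongr
            · exact norm_primitiveL_sub_le t s p
            · exact hQ s
        _ = _ := by ring
  have hac : AbsolutelyContinuousOnInterval h 0 1 :=
    hlip.lipschitzOnWith.absolutelyContinuousOnInterval
  have hd : ∀ᵐ t, t ∈ uIcc (0 : ℝ) 1 → HasDerivAt h 0 t := by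
    rw [uIcc_of_le zero_le_one]
    filter_upwards [ae_hasDerivAt_primitiveL p, ae_hasDerivAt_primitiveL w,
      ae_hasDerivAt_primitiveL k, (ae_restrict_iff' measurableSet_Icc).1 hk] with t h1 h2 h3 h4 h5
    have hB := (B.hasFDerivAt.comp_hasDerivAt t ((h1 h5).const_add a)).clm_apply
      ((h2 h5).const_add b)
    exact (hB.sub (h3 h5)).congr_deriv (by rw [h4 h5]; exact sub_self _)
  obtain ⟨C, hC⟩ := hac.const_of_ae_hasDerivAt_zero hd
  rw [uIcc_of_le zero_le_one] at hC
  have e0 := hC 0 (by simp)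
  have et := hC t ht
  rw [← e0] at et
  simp only [hh, primitiveL_zero, add_zero, sub_zero] at et
  exact sub_eq_iff_eq_add.1 et

end ProductRule

/-! ### Smoothness from an implicit equation. -/

section Implicit

variable {V Y : Type*} [NormedAddCommGroup V] [NormedSpace ℝ V] [CompleteSpace V]
  [NormedAddCommGroup Y] [NormedSpace ℝ Y] [CompleteSpace Y]

/-- A map defined uniquely by a smooth, nondegenerate implicit equation is smooth. -/
theorem contDiff_of_implicit {G : V × Y → Y} (hG : ContDiff ℝ ∞ G) {S : V → Y}
    (hS : ∀ u, G (u, S u) = 0) (huniq : ∀ u y, G (u, y) = 0 → y = S u)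
    (hinv : ∀ u, ∃ L : V × Y →L[ℝ] Y, HasFDerivAt G L (u, S u) ∧
      (L ∘L .inr ℝ V Y).IsInvertible) : ContDiff ℝ ∞ S := by
  rw [contDiff_iff_contDiffAt]
  intro u
  obtain ⟨L, hL, hi⟩ := hinv u
  rw [← hL.fderiv] at hi
  have hGa : ContDiffAt ℝ ∞ G (u, S u) := hG.contDiffAt
  -- Global uniqueness of zeros identifies `S` with the local implicit function, with no prior
  -- continuity of `S`.
  refine (hGa.contDiffAt_implicitFunction (by simp) hi).congr_of_eventuallyEq ?_
  filter_upwards [hGa.eventually_apply_implicitFunction (by simp) hi] with v hv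
  exact (huniq _ _ (hv.trans (hS u))).symm

end Implicit

/-! ### Dependence of trajectories on the control. -/

section SolutionMap

universe w

variable {X P : Type w} [NormedAddCommGroup X] [NormedSpace ℝ X]
  [NormedAddCommGroup P] [NormedSpace ℝ P]

/-- The pairing of two `L^∞` functions. -/
noncomputable def pairL (X P : Type*) [NormedAddCommGroup X] [NormedSpace ℝ X]
    [NormedAddCommGroup P] [NormedSpace ℝ P] :
    Lp X ∞ unitMeasure × Lp P ∞ unitMeasure →L[ℝ] Lp (X × P) ∞ unitMeasure :=
  ((ContinuousLinearMap.inl ℝ X P).compLpL ∞ unitMeasure).comp (ContinuousLinearMap.fst ℝ _ _) +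
    ((ContinuousLinearMap.inr ℝ X P).compLpL ∞ unitMeasure).comp (ContinuousLinearMap.snd ℝ _ _)

theorem coeFn_pairL (ξ : Lp X ∞ unitMeasure) (u : Lp P ∞ unitMeasure) :
    pairL X P (ξ, u) =ᵐ[unitMeasure] fun t => (ξ t, u t) := by
  have h : pairL X P (ξ, u) = (ContinuousLinearMap.inl ℝ X P).compLpL ∞ unitMeasure ξ +
    (ContinuousLinearMap.inr ℝ X P).compLpL ∞ unitMeasure u := rfl
  rw [h]
  filter_upwards [Lp.coeFn_add ((ContinuousLinearMap.inl ℝ X P).compLpL ∞ unitMeasure ξ)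
    ((ContinuousLinearMap.inr ℝ X P).compLpL ∞ unitMeasure u),
    (ContinuousLinearMap.inl ℝ X P).coeFn_compLpL (p := ∞) ξ,
    (ContinuousLinearMap.inr ℝ X P).coeFn_compLpL (p := ∞) u] with t h1 h2 h3
  rw [h1, Pi.add_apply, h2, h3]
  simp

/-- Precomposition of an operator-valued `L^∞` function with the first inclusion. -/
noncomputable def restrictFstL (X P : Type*) [NormedAddCommGroup X] [NormedSpace ℝ X]
    [NormedAddCommGroup P] [NormedSpace ℝ P] :
    Lp (X × P →L[ℝ] X) ∞ unitMeasure →L[ℝ] Lp (X →L[ℝ] X) ∞ unitMeasure :=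
  ((ContinuousLinearMap.compL ℝ X (X × P) X).flip (ContinuousLinearMap.inl ℝ X P)).compLpL
    ∞ unitMeasure

theorem coeFn_restrictFstL (D : Lp (X × P →L[ℝ] X) ∞ unitMeasure) :
    restrictFstL X P D =ᵐ[unitMeasure]
      fun t => (D t).comp (ContinuousLinearMap.inl ℝ X P) :=
  ContinuousLinearMap.coeFn_compLpL _ D

theorem applyL_restrictFstL (D : Lp (X × P →L[ℝ] X) ∞ unitMeasure) (h : Lp X ∞ unitMeasure) :
    applyL unitMeasure X X (restrictFstL X P D) h =
      applyL unitMeasure (X × P) X D (pairL X P (h, 0)) := by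
  apply Lp.ext
  filter_upwards [coeFn_applyL (restrictFstL X P D) h, coeFn_applyL D (pairL X P (h, 0)),
    coeFn_restrictFstL D, coeFn_pairL h (0 : Lp P ∞ unitMeasure),
    Lp.coeFn_zero P ∞ unitMeasure] with t h1 h2 h3 h4 h5
  rw [h1, h2, h3, h4, h5]
  simp

variable [FiniteDimensional ℝ X] [FiniteDimensional ℝ P] {F : X × P → X} (hF : ContDiff ℝ ∞ F)

/-- The derivative of `F` along a pair of `L^∞` functions. -/
noncomputable def derivAlong {X P : Type*} [NormedAddCommGroup X] [NormedSpace ℝ X]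
    [NormedAddCommGroup P] [NormedSpace ℝ P] [FiniteDimensional ℝ X] [FiniteDimensional ℝ P]
    {F : X × P → X} (hF : ContDiff ℝ ∞ F) (z : Lp X ∞ unitMeasure × Lp P ∞ unitMeasure) :
    Lp (X × P →L[ℝ] X) ∞ unitMeasure :=
  nemytskii (fderiv ℝ F) (contDiff_infty_iff_fderiv.1 hF).2.continuous (pairL X P z)

/-- The velocity `t ↦ F (ξ t, u t)` along a pair of `L^∞` functions. -/
noncomputable def velocity {X P : Type*} [NormedAddCommGroup X] [NormedSpace ℝ X]
    [NormedAddCommGroup P] [NormedSpace ℝ P] [FiniteDimensional ℝ X] [FiniteDimensional ℝ P]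
    {F : X × P → X} (hF : ContDiff ℝ ∞ F) (z : Lp X ∞ unitMeasure × Lp P ∞ unitMeasure) :
    Lp X ∞ unitMeasure :=
  nemytskii F hF.continuous (pairL X P z)

theorem coeFn_velocity (ξ : Lp X ∞ unitMeasure) (u : Lp P ∞ unitMeasure) :
    velocity hF (ξ, u) =ᵐ[unitMeasure] fun t => F (ξ t, u t) := by
  filter_upwards [coeFn_nemytskii hF.continuous (pairL X P (ξ, u)), coeFn_pairL ξ u] with t h1 h2
  rw [velocity, h1, h2]

theorem coeFn_derivAlong (ξ : Lp X ∞ unitMeasure) (u : Lp P ∞ unitMeasure) :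
    derivAlong hF (ξ, u) =ᵐ[unitMeasure] fun t => fderiv ℝ F (ξ t, u t) := by
  filter_upwards [coeFn_nemytskii (contDiff_infty_iff_fderiv.1 hF).2.continuous
    (pairL X P (ξ, u)), coeFn_pairL ξ u] with t h1 h2
  rw [derivAlong, h1, h2]

theorem contDiff_velocity : ContDiff ℝ ∞ (velocity hF) :=
  (contDiff_nemytskii hF).comp (pairL X P).contDiff

theorem continuous_derivAlong : Continuous (derivAlong hF) :=
  (contDiff_nemytskii (contDiff_infty_iff_fderiv.1 hF).2).continuous.comp (pairL X P).continuous

theorem hasFDerivAt_velocity (z : Lp X ∞ unitMeasure × Lp P ∞ unitMeasure) :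
    HasFDerivAt (velocity hF)
      ((applyL unitMeasure (X × P) X (derivAlong hF z)).comp (pairL X P)) z :=
  (hasFDerivAt_nemytskii (hF.of_le (by simp)) (pairL X P z)).comp z (pairL X P).hasFDerivAt

theorem hasFDerivAt_velocity_comp {Y : Type*} [NormedAddCommGroup Y] [NormedSpace ℝ Y]
    {a : Y → Lp X ∞ unitMeasure} {b : Y → Lp P ∞ unitMeasure}
    {a' : Y →L[ℝ] Lp X ∞ unitMeasure} {b' : Y →L[ℝ] Lp P ∞ unitMeasure} {y : Y}
    (ha : HasFDerivAt a a' y) (hb : HasFDerivAt b b' y) :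
    HasFDerivAt (fun y => velocity hF (a y, b y))
      (((applyL unitMeasure (X × P) X (derivAlong hF (a y, b y))).comp (pairL X P)).comp
        (a'.prod b')) y :=
  HasFDerivAt.comp (f := fun y => (a y, b y)) y (hasFDerivAt_velocity hF (a y, b y))
    (ha.prodMk hb)

/-- A Carathéodory solution is determined, as an `L^∞` function, by its integral equation. -/
theorem solution_unique {c ξ η : Lp X ∞ unitMeasure} {u : Lp P ∞ unitMeasure}
    (hξ : ξ = c + volterra X (velocity hF (ξ, u)))
    (hη : η = c + volterra X (velocity hF (η, u))) : ξ = η := by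
  -- Averaging the derivative along the segment from `η` to `ξ` gives `D` with `F(ξ, u) - F(η, u) =
  -- D (ξ - η)`. Then `ξ - η` lies in the kernel of the invertible operator `1 - volterraMul D`.
  set A : ℝ → Lp (X →L[ℝ] X) ∞ unitMeasure := fun θ =>
    restrictFstL X P (derivAlong hF (η + θ • (ξ - η), u)) with hA
  have hAc : Continuous A := (restrictFstL X P).continuous.comp
    ((continuous_derivAlong hF).comp (by fun_prop))
  have hder : ∀ θ : ℝ, HasDerivAt (fun θ : ℝ => velocity hF (η + θ • (ξ - η), u))
      (applyL unitMeasure X X (A θ) (ξ - η)) θ := by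
    intro θ
    have h1 : HasDerivAt (fun θ : ℝ => (η + θ • (ξ - η), u)) (ξ - η, 0) θ := by
      have := ((hasDerivAt_id θ).smul_const (ξ - η)).const_add η
      rw [one_smul] at this
      exact this.prodMk (hasDerivAt_const θ u)
    rw [hA, applyL_restrictFstL]
    exact (hasFDerivAt_velocity hF _).comp_hasDerivAt θ h1
  have hcont : Continuous fun θ => applyL unitMeasure X X (A θ) (ξ - η) := by fun_prop
  have hint := intervalIntegral.integral_eq_sub_of_hasDerivAt (a := 0) (b := 1)
    (fun θ _ => hder θ) (hcont.intervalIntegrable 0 1)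
  set D := ∫ θ in (0 : ℝ)..1, A θ with hD
  have hDa : ∫ θ in (0 : ℝ)..1, applyL unitMeasure X X (A θ) (ξ - η) =
      applyL unitMeasure X X D (ξ - η) :=
    ((applyL unitMeasure X X).flip (ξ - η)).intervalIntegral_comp_comm
      (hAc.intervalIntegrable 0 1)
  rw [hDa] at hint
  simp only [one_smul, zero_smul, add_zero, add_sub_cancel] at hint
  have h0 : (1 - volterraMul D) (ξ - η) = 0 := by
    have : volterraMul D (ξ - η) = ξ - η := by
      change volterra X (applyL unitMeasure X X D (ξ - η)) = ξ - η
      rw [hint, map_sub]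
      conv_rhs => rw [hξ, hη]
      abel
    rw [sub_apply, this]
    simp
  have hbij := ((ContinuousLinearMap.isUnit_iff_bijective).1 (isUnit_one_sub_volterraMul D)).1
  exact sub_eq_zero.1 (hbij (h0.trans (map_zero _).symm))

/-- The solution of a controlled system depends smoothly on the control. -/
theorem contDiff_solution {c : Lp X ∞ unitMeasure}
    {S : Lp P ∞ unitMeasure → Lp X ∞ unitMeasure}
    (hS : ∀ u, S u = c + volterra X (velocity hF (S u, u))) : ContDiff ℝ ∞ S := by
  refine contDiff_of_implicit (G := fun z => z.2 - (c + volterra X (velocity hF (z.2, z.1))))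
    ?_ (fun u => sub_eq_zero.2 (hS u))
    (fun u η hη => solution_unique hF (sub_eq_zero.1 hη) (hS u)) fun u => ?_
  · exact contDiff_snd.sub (contDiff_const.add ((volterra X).contDiff.comp
      ((contDiff_velocity hF).comp (contDiff_snd.prodMk contDiff_fst))))
  · refine ⟨_, hasFDerivAt_snd.sub (((volterra X).hasFDerivAt.comp _
      (hasFDerivAt_velocity_comp hF hasFDerivAt_snd hasFDerivAt_fst)).const_add c), ?_⟩
    obtain ⟨U, hU⟩ := isUnit_one_sub_volterraMul (restrictFstL X P (derivAlong hF (S u, u)))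
    refine ⟨ContinuousLinearEquiv.unitsEquiv ℝ _ U, hU.trans ?_⟩
    ext1 h
    have e := applyL_restrictFstL (derivAlong hF (S u, u)) h
    exact congrArg (fun w => h - volterra X w) e

/-- The variational equation satisfied by the derivative of the solution map. -/
theorem fderiv_solution {c : Lp X ∞ unitMeasure}
    {S : Lp P ∞ unitMeasure → Lp X ∞ unitMeasure}
    (hS : ∀ u, S u = c + volterra X (velocity hF (S u, u))) (u v : Lp P ∞ unitMeasure) :
    fderiv ℝ S u v = volterra X (applyL unitMeasure (X × P) X (derivAlong hF (S u, u))
      (pairL X P (fderiv ℝ S u v, v))) := by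
  have hd : HasFDerivAt S (fderiv ℝ S u) u :=
    ((contDiff_solution hF hS).differentiable (by simp) u).hasFDerivAt
  have h2 := ((volterra X).hasFDerivAt.comp u (hasFDerivAt_velocity_comp hF hd (hasFDerivAt_id u))).const_add c
  have h3 : HasFDerivAt S _ u := h2.congr_of_eventuallyEq (Eventually.of_forall hS)
  exact congrArg (fun L => L v) (hd.unique h3)

theorem hasFDerivAt_endpoint {c : Lp X ∞ unitMeasure} (x : X)
    {S : Lp P ∞ unitMeasure → Lp X ∞ unitMeasure}
    (hS : ∀ u, S u = c + volterra X (velocity hF (S u, u))) (u : Lp P ∞ unitMeasure) :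
    HasFDerivAt (fun u => x + primitiveL X 1 (velocity hF (S u, u)))
      ((primitiveL X 1).comp (((applyL unitMeasure (X × P) X (derivAlong hF (S u, u))).comp
        (pairL X P)).comp ((fderiv ℝ S u).prod (ContinuousLinearMap.id ℝ _)))) u := by
  have hd : HasFDerivAt S (fderiv ℝ S u) u :=
    ((contDiff_solution hF hS).differentiable (by simp) u).hasFDerivAt
  exact ((primitiveL X 1).hasFDerivAt.comp u (hasFDerivAt_velocity_comp hF hd (hasFDerivAt_id u))).const_add x

theorem contDiff_endpoint {c : Lp X ∞ unitMeasure} (x : X)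
    {S : Lp P ∞ unitMeasure → Lp X ∞ unitMeasure}
    (hS : ∀ u, S u = c + volterra X (velocity hF (S u, u))) :
    ContDiff ℝ ∞ (fun u => x + primitiveL X 1 (velocity hF (S u, u))) :=
  contDiff_const.add ((primitiveL X 1).contDiff.comp ((contDiff_velocity hF).comp
    ((contDiff_solution hF hS).prodMk contDiff_id)))

end SolutionMap

/-! ### Level sets of submersions. -/

section LevelSets

variable {X Y : Type*} [NormedAddCommGroup X] [NormedSpace ℝ X]
  [NormedAddCommGroup Y] [NormedSpace ℝ Y]

/-- Holds without surjectivity of `L`, so it applies at points where controllability is not known.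
-/
theorem tangentAt_levelSet_subset {g : X → Y} {L : X →L[ℝ] Y} {u : X} {y : Y}
    (hg : HasFDerivAt g L u) : tangentAt {w | g w = y} u ⊆ {v | L v = 0} := by
  rintro v ⟨γ, h0, -, hd, hS⟩
  subst h0
  have h1 : HasDerivAt (fun t => g (γ t)) (L v) 0 := hg.comp_hasDerivAt 0 hd
  have h2 : HasDerivAt (fun t => g (γ t)) 0 0 :=
    (hasDerivAt_const (0 : ℝ) y).congr_of_eventuallyEq hS
  exact h1.unique h2

variable [CompleteSpace X] [FiniteDimensional ℝ Y]

/-- A local chart straightening the level set of a smooth submersion onto the kernel of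
its derivative, tangent to the identity. -/
theorem exists_chart_levelSet {g : X → Y} {L : X →L[ℝ] Y} {u : X}
    (hg : ContDiff ℝ ∞ g) (hL : HasFDerivAt g L u) (hsurj : Function.Surjective L) :
    L.ker.ClosedComplemented ∧ ∃ χ : OpenPartialHomeomorph X X, u ∈ χ.source ∧
      ContDiffOn ℝ ∞ χ χ.source ∧ ContDiffOn ℝ ∞ χ.symm χ.target ∧
      (∀ w ∈ χ.source, g w = g u ↔ χ w ∈ L.ker) ∧
      HasFDerivAt χ (ContinuousLinearMap.id ℝ X) u := by
  obtain ⟨s₀, hs₀⟩ := (L : X →ₗ[ℝ] Y).exists_rightInverse_of_surjective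
    (LinearMap.range_eq_top.2 hsurj)
  set s : Y →L[ℝ] X := s₀.toContinuousLinearMap
  have hs : ∀ y, L (s y) = y := fun y => congrArg (fun T => T y) hs₀
  refine ⟨ContinuousLinearMap.closedComplemented_ker_of_rightInverse L s hs, ?_⟩
  -- With `s` a right inverse of `L`, this replaces the component `s (L w)` by `s (g w - g u)`.
  -- Hence `L (ψ w) = g w - g u`, and the derivative of `ψ` at `u` is the identity.
  set ψ : X → X := fun w => w - s (L w) + s (g w - g u) with hψ
  have hψs : ContDiff ℝ ∞ ψ := by
    have := s.contDiff (n := ∞)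
    have := L.contDiff (n := ∞)
    fun_prop
  have hψd : HasFDerivAt ψ (ContinuousLinearMap.id ℝ X) u := by
    have h := ((hasFDerivAt_id u).sub (s.hasFDerivAt.comp u L.hasFDerivAt)).add
      (s.hasFDerivAt.comp u (hL.sub_const (g u)))
    rw [sub_add_cancel] at h
    exact h
  set χ₀ : OpenPartialHomeomorph X X := hψs.contDiffAt.toOpenPartialHomeomorph ψ
    (f' := ContinuousLinearEquiv.refl ℝ X) hψd (by simp)
  have hu₀ : u ∈ χ₀.source := ContDiffAt.mem_toOpenPartialHomeomorph_source _ _ _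
  -- Restricting to points with invertible derivative makes the inverse chart smooth on its whole
  -- target, not only at the image of `u`.
  set W : Set X := {w | fderiv ℝ ψ w ∈ range ((↑) : (X ≃L[ℝ] X) → X →L[ℝ] X)} with hW
  have hWo : IsOpen W :=
    ContinuousLinearEquiv.isOpen.preimage (hψs.continuous_fderiv (by simp))
  have huW : u ∈ W := ⟨ContinuousLinearEquiv.refl ℝ X, hψd.fderiv.symm⟩
  refine ⟨χ₀.restrOpen W hWo, ⟨hu₀, huW⟩, hψs.contDiffOn, ?_, ?_, hψd⟩
  · intro z hz
    have hzs := (χ₀.restrOpen W hWo).map_target hz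
    obtain ⟨e, he⟩ := hzs.2
    refine ContDiffAt.contDiffWithinAt ?_
    refine (χ₀.restrOpen W hWo).contDiffAt_symm (f₀' := e) hz ?_ hψs.contDiffAt
    have := (hψs.differentiable (by simp) ((χ₀.restrOpen W hWo).symm z)).hasFDerivAt
    rw [he]
    exact this
  · intro w _
    change _ ↔ L (ψ w) = 0
    simp only [hψ, map_add, map_sub, hs, sub_self, zero_add, sub_eq_zero]

theorem isSubmanifoldAt_levelSet {g : X → Y} {L : X →L[ℝ] Y} {u : X}
    (hg : ContDiff ℝ ∞ g) (hL : HasFDerivAt g L u) (hsurj : Function.Surjective L) :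
    IsSubmanifoldAt {w | g w = g u} u := by
  obtain ⟨hc, χ, hu, h1, h2, h3, -⟩ := exists_chart_levelSet hg hL hsurj
  exact ⟨L.ker, χ, hc, hu, h1, h2, h3⟩

theorem tangentAt_levelSet {g : X → Y} {L : X →L[ℝ] Y} {u : X}
    (hg : ContDiff ℝ ∞ g) (hL : HasFDerivAt g L u) (hsurj : Function.Surjective L) :
    tangentAt {w | g w = g u} u = {v | L v = 0} := by
  refine (tangentAt_levelSet_subset hL).antisymm fun v hv => ?_
  obtain ⟨-, χ, hu, h1, h2, h3, h4⟩ := exists_chart_levelSet hg hL hsurj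
  have hχu : χ u ∈ χ.target := χ.map_source hu
  have hsymm : χ.symm (χ u) = u := χ.left_inv hu
  have hline : HasDerivAt (fun t : ℝ => χ u + t • v) v 0 := by
    simpa using ((hasDerivAt_id (0 : ℝ)).smul_const v).const_add (χ u)
  have hz : χ u + (0 : ℝ) • v = χ u := by simp
  have hd : HasFDerivAt χ.symm (ContinuousLinearMap.id ℝ X) (χ u) :=
    χ.hasFDerivAt_symm (f' := ContinuousLinearEquiv.refl ℝ X) hχu (by rw [hsymm]; exact h4)
  -- The curve is a straight line in the kernel pulled back by the chart; its velocity is `v`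
  -- because the chart is tangent to the identity.
  refine ⟨fun t => χ.symm (χ u + t • v), by simp [hsymm], ?_, ?_, ?_⟩
  · refine ContDiffAt.comp (0 : ℝ) (g := χ.symm) ?_ (by fun_prop)
    rw [hz]
    exact ((h2 _ hχu).contDiffAt (χ.open_target.mem_nhds hχu)).of_le (by simp)
  · exact HasFDerivAt.comp_hasDerivAt (0 : ℝ) (l := χ.symm) (by rw [hz]; exact hd) hline
  · have hc : ContinuousAt (fun t : ℝ => χ u + t • v) 0 := hline.continuousAt
    have hev := hc.eventually_mem (s := χ.target)
      (by rw [hz]; exact χ.open_target.mem_nhds hχu)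
    filter_upwards [hev] with t ht
    refine (h3 _ (χ.map_target ht)).2 ?_
    rw [χ.right_inv ht]
    have hv' : v ∈ L.ker := hv
    exact L.ker.add_mem ((h3 u hu).1 rfl) (L.ker.smul_mem t hv')

end LevelSets

/-! ### Linear equations with `L^∞` coefficients. -/

theorem memLp_top_of_continuousOn_unit {E : Type*} [NormedAddCommGroup E] {ξ : ℝ → E}
    (hξ : ContinuousOn ξ (Icc 0 1)) : MemLp ξ ∞ unitMeasure := by
  obtain ⟨C, hC⟩ := isCompact_Icc.exists_bound_of_continuousOn hξ
  refine memLp_top_of_bound (hξ.aestronglyMeasurable_of_isCompact isCompact_Icc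
    measurableSet_Icc) C ?_
  filter_upwards [ae_restrict_mem measurableSet_Icc] with t ht using hC t ht

theorem intervalIntegral_eq_primitiveL_sub {E : Type*} [NormedAddCommGroup E] [NormedSpace ℝ E]
    {w : Lp E ∞ unitMeasure} {g : ℝ → E} (h : w =ᵐ[unitMeasure] g) {τ t : ℝ}
    (hτ : τ ∈ Icc (0 : ℝ) 1) (ht : t ∈ Icc (0 : ℝ) 1) :
    ∫ s in τ..t, g s = primitiveL E t w - primitiveL E τ w := by
  rw [primitiveL_apply, primitiveL_apply, intervalIntegral.integral_interval_sub_left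
    (Linfty.integrable w).intervalIntegrable (Linfty.integrable w).intervalIntegrable,
    ← intervalIntegral_unitMeasure hτ ht]
  exact intervalIntegral.integral_congr_ae (h.symm.mono fun s hs _ => hs)

/-- Existence for linear equations with `L^∞` coefficients. -/
theorem exists_linear_solution {W : Type*} [NormedAddCommGroup W] [NormedSpace ℝ W]
    [CompleteSpace W] (A : Lp (W →L[ℝ] W) ∞ unitMeasure) (c : W) :
    ∃ w : Lp W ∞ unitMeasure, w =ᵐ[unitMeasure] fun s => A s (c + primitiveL W s w) := by
  obtain ⟨X, hX⟩ := ((ContinuousLinearMap.isUnit_iff_bijective).1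
    (isUnit_one_sub_volterraMul A)).2 (Lp.const ∞ unitMeasure c)
  have hX' : X = Lp.const ∞ unitMeasure c + volterra W (applyL unitMeasure W W A X) :=
    sub_eq_iff_eq_add.1 hX
  refine ⟨applyL unitMeasure W W A X, ?_⟩
  filter_upwards [coeFn_applyL A X, coeFn_volterra (applyL unitMeasure W W A X),
    Lp.coeFn_add (Lp.const ∞ unitMeasure c) (volterra W (applyL unitMeasure W W A X)),
    Lp.coeFn_const ∞ unitMeasure c] with s h1 h2 h3 h4
  rw [← hX', Pi.add_apply, h2, h4] at h3
  rw [h1, h3]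
  rfl

/-- The fundamental solution of a linear equation and its inverse, as primitives. -/
theorem exists_fundamental_pair {E : Type*} [NormedAddCommGroup E] [NormedSpace ℝ E]
    [FiniteDimensional ℝ E] (A : Lp (E →L[ℝ] E) ∞ unitMeasure) :
    ∃ a b : Lp (E →L[ℝ] E) ∞ unitMeasure,
      (a =ᵐ[unitMeasure] fun s => (A s).comp (.id ℝ E + primitiveL _ s a)) ∧
      (b =ᵐ[unitMeasure] fun s => -((.id ℝ E + primitiveL (E →L[ℝ] E) s b).comp (A s))) ∧
      ∀ t ∈ Icc (0 : ℝ) 1, (ContinuousLinearMap.id ℝ E + primitiveL _ t a).comp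
        (.id ℝ E + primitiveL _ t b) = .id ℝ E := by
  have := FiniteDimensional.complete ℝ E
  obtain ⟨a, ha⟩ := exists_linear_solution
    ((ContinuousLinearMap.compL ℝ E E E).compLpL ∞ unitMeasure A) (.id ℝ E)
  obtain ⟨b, hb⟩ := exists_linear_solution
    ((-(ContinuousLinearMap.compL ℝ E E E).flip).compLpL ∞ unitMeasure A) (.id ℝ E)
  have ha' : a =ᵐ[unitMeasure] fun s => (A s).comp (.id ℝ E + primitiveL _ s a) := by
    filter_upwards [ha, (ContinuousLinearMap.compL ℝ E E E).coeFn_compLpL (p := ∞) A]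
      with s h1 h2
    rw [h1, h2]
    rfl
  have hb' : b =ᵐ[unitMeasure]
      fun s => -((.id ℝ E + primitiveL (E →L[ℝ] E) s b).comp (A s)) := by
    filter_upwards [hb, (-(ContinuousLinearMap.compL ℝ E E E).flip).coeFn_compLpL (p := ∞) A]
      with s h1 h2
    rw [h1, h2]
    rfl
  refine ⟨a, b, ha', hb', fun t ht => ?_⟩
  have h := bilin_primitiveL (ContinuousLinearMap.compL ℝ E E E) b a (.id ℝ E) (.id ℝ E) 0 ?_ ht
  · rw [map_zero, add_zero] at h
    -- The product rule gives only a left inverse; in finite dimension it is also a right inverse.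
    have h' : ((ContinuousLinearMap.id ℝ E + primitiveL _ t b : E →L[ℝ] E) : E →ₗ[ℝ] E) *
        ((.id ℝ E + primitiveL _ t a : E →L[ℝ] E) : E →ₗ[ℝ] E) = 1 :=
      congrArg (fun T : E →L[ℝ] E => (T : E →ₗ[ℝ] E)) h
    ext v
    exact congrArg (fun T => T v) (mul_eq_one_comm.1 h')
  · filter_upwards [ha', hb', Lp.coeFn_zero (E →L[ℝ] E) ∞ unitMeasure] with s h1 h2 h3
    rw [h3, h1, h2]
    ext1 v
    simp
    abel

/-! ### The end-point map and its derivative. -/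

section Flow

variable {n p : ℕ} {f : Eu n → Eu p → Eu n}

theorem isTrajectory_flow (hflow : HasFlow f) (u : Control p) (x : Eu n) :
    IsTrajectory f u x (flow f u x) :=
  Classical.epsilon_spec (hflow u x)

/-- The flow, as an `L^∞` function of time. -/
noncomputable def flowClass (hflow : HasFlow f) (x : Eu n) (u : Control p) :
    Lp (Eu n) ∞ unitMeasure :=
  (memLp_top_of_continuousOn_unit (isTrajectory_flow hflow u x).1).toLp

theorem coeFn_flowClass (hflow : HasFlow f) (x : Eu n) (u : Control p) :
    flowClass hflow x u =ᵐ[unitMeasure] flow f u x :=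
  MemLp.coeFn_toLp _

theorem flow_eq_primitiveL
    (hf : ContDiff ℝ ∞ (fun z : Eu n × Eu p => f z.1 z.2))
    (hflow : HasFlow f) (x : Eu n) (u : Control p) {t : ℝ}
    (ht : t ∈ Icc (0 : ℝ) 1) :
    flow f u x t = x + primitiveL (Eu n) t (velocity hf (flowClass hflow x u, u)) := by
  rw [(isTrajectory_flow hflow u x).2 t ht]
  congr 1
  refine (primitiveL_eq ht ?_).symm
  filter_upwards [coeFn_velocity hf (flowClass hflow x u) u, coeFn_flowClass hflow x u]
    with s h1 h2
  rw [h1, h2]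

theorem flowClass_eq
    (hf : ContDiff ℝ ∞ (fun z : Eu n × Eu p => f z.1 z.2))
    (hflow : HasFlow f) (x : Eu n) (u : Control p) :
    flowClass hflow x u = Lp.const ∞ unitMeasure x +
      volterra (Eu n) (velocity hf (flowClass hflow x u, u)) := by
  apply Lp.ext
  filter_upwards [coeFn_flowClass hflow x u, ae_restrict_mem measurableSet_Icc,
    coeFn_volterra (velocity hf (flowClass hflow x u, u)),
    Lp.coeFn_add (Lp.const ∞ unitMeasure x)
      (volterra (Eu n) (velocity hf (flowClass hflow x u, u))),
    Lp.coeFn_const ∞ unitMeasure x] with t h1 h2 h3 h4 h5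
  rw [h4, Pi.add_apply, h3, h5, h1, flow_eq_primitiveL hf hflow x u h2]
  rfl

theorem linA_eq
    (hf : ContDiff ℝ ∞ (fun z : Eu n × Eu p => f z.1 z.2))
    (u : Control p) (x : Eu n) (t : ℝ) :
    linA f u x t = (fderiv ℝ (fun z : Eu n × Eu p => f z.1 z.2) (flow f u x t, u t)).comp
      (.inl ℝ (Eu n) (Eu p)) := by
  have h := ((hf.differentiable (by simp)) (flow f u x t, u t)).hasFDerivAt
  exact (h.comp (f := fun a => (a, u t)) (flow f u x t) (hasFDerivAt_prodMk_left (flow f u x t) (u t))).fderiv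

theorem linB_eq
    (hf : ContDiff ℝ ∞ (fun z : Eu n × Eu p => f z.1 z.2))
    (u : Control p) (x : Eu n) (t : ℝ) :
    linB f u x t = (fderiv ℝ (fun z : Eu n × Eu p => f z.1 z.2) (flow f u x t, u t)).comp
      (.inr ℝ (Eu n) (Eu p)) := by
  have h := ((hf.differentiable (by simp)) (flow f u x t, u t)).hasFDerivAt
  exact (h.comp (f := fun c => (flow f u x t, c)) (u t) (hasFDerivAt_prodMk_right (flow f u x t) (u t))).fderiv

theorem coeFn_restrictFstL_derivAlong
    (hf : ContDiff ℝ ∞ (fun z : Eu n × Eu p => f z.1 z.2))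
    (hflow : HasFlow f) (x : Eu n) (u : Control p) :
    restrictFstL (Eu n) (Eu p) (derivAlong hf (flowClass hflow x u, u))
      =ᵐ[unitMeasure] linA f u x := by
  filter_upwards [coeFn_restrictFstL (derivAlong hf (flowClass hflow x u, u)),
    coeFn_derivAlong hf (flowClass hflow x u) u, coeFn_flowClass hflow x u] with t h1 h2 h3
  rw [h1, h2, h3, linA_eq hf]

theorem coeFn_applyL_derivAlong
    (hf : ContDiff ℝ ∞ (fun z : Eu n × Eu p => f z.1 z.2))
    (hflow : HasFlow f) (x : Eu n) (u v : Control p)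
    (z : Lp (Eu n) ∞ unitMeasure) :
    applyL unitMeasure (Eu n × Eu p) (Eu n) (derivAlong hf (flowClass hflow x u, u))
      (pairL (Eu n) (Eu p) (z, v)) =ᵐ[unitMeasure]
      fun t => linA f u x t (z t) + linB f u x t (v t) := by
  filter_upwards [coeFn_applyL (derivAlong hf (flowClass hflow x u, u))
    (pairL (Eu n) (Eu p) (z, v)), coeFn_derivAlong hf (flowClass hflow x u) u,
    coeFn_flowClass hflow x u, coeFn_pairL z v] with t h1 h2 h3 h4
  rw [h1, h2, h3, h4, linA_eq hf, linB_eq hf, ContinuousLinearMap.comp_apply,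
    ContinuousLinearMap.comp_apply, ← map_add]
  simp

/-- This is `Φ(t, τ) = Z(t) Z(τ)⁻¹`, with `Z` the fundamental solution and `Y = Z(τ)⁻¹`. It supplies
the existence that gives the `Classical.epsilon` in `transition` its meaning. -/
theorem isTransition_fundamental {u : Control p} {x : Eu n}
    {A a : Lp (Eu n →L[ℝ] Eu n) ∞ unitMeasure}
    (hA : A =ᵐ[unitMeasure] linA f u x)
    (ha : a =ᵐ[unitMeasure] fun s => (A s).comp (.id ℝ (Eu n) + primitiveL _ s a))
    {τ : ℝ} (hτ : τ ∈ Icc (0 : ℝ) 1) {Y : Eu n →L[ℝ] Eu n}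
    (hY : (ContinuousLinearMap.id ℝ (Eu n) + primitiveL _ τ a).comp Y = .id ℝ (Eu n)) :
    IsTransition f u x τ fun t =>
      (ContinuousLinearMap.id ℝ (Eu n) + primitiveL _ t a).comp Y := by
  obtain ⟨k, hkd⟩ : ∃ k : (Eu n →L[ℝ] Eu n) →L[ℝ] Eu n →L[ℝ] Eu n, ∀ T, k T = T.comp Y :=
    ⟨(ContinuousLinearMap.compL ℝ (Eu n) (Eu n) (Eu n)).flip Y, fun _ => rfl⟩
  simp only [← hkd] at hY ⊢
  refine ⟨(k.continuous.comp
    (continuous_const.add (continuous_primitiveL a))).continuousOn, fun t ht => ?_⟩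
  have hk : k.compLpL ∞ unitMeasure a =ᵐ[unitMeasure] fun s => (linA f u x s).comp
      (k (ContinuousLinearMap.id ℝ (Eu n) + primitiveL _ s a)) := by
    filter_upwards [k.coeFn_compLpL (p := ∞) a, ha, hA] with s h1 h2 h3
    rw [h1, h2, h3, hkd, hkd, ContinuousLinearMap.comp_assoc]
  have hkp : ∀ r, primitiveL _ r (k.compLpL ∞ unitMeasure a) = k (primitiveL _ r a) := by
    intro r
    rw [primitiveL_apply, primitiveL_apply, ← k.intervalIntegral_comp_comm
      (Linfty.integrable a).intervalIntegrable]
    exact intervalIntegral.integral_congr_ae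
      ((k.coeFn_compLpL (p := ∞) a).mono fun s hs _ => hs)
  beta_reduce
  rw [intervalIntegral_eq_primitiveL_sub hk hτ ht, hkp, hkp, map_add]
  rw [map_add] at hY
  rw [eq_sub_of_add_eq hY]
  abel

/-- Uniqueness at time 1: the inverse fundamental solution times `Ψ` has zero derivative, so its
values at `1` and `τ` agree. -/
theorem IsTransition.apply_one {u : Control p} {x : Eu n}
    {A b : Lp (Eu n →L[ℝ] Eu n) ∞ unitMeasure}
    (hA : A =ᵐ[unitMeasure] linA f u x)
    (hb : b =ᵐ[unitMeasure]
      fun s => -((.id ℝ (Eu n) + primitiveL (Eu n →L[ℝ] Eu n) s b).comp (A s)))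
    {τ : ℝ} (hτ : τ ∈ Icc (0 : ℝ) 1) {Ψ : ℝ → Eu n →L[ℝ] Eu n} (h : IsTransition f u x τ Ψ) :
    (ContinuousLinearMap.id ℝ (Eu n) + primitiveL _ 1 b).comp (Ψ 1) =
      .id ℝ (Eu n) + primitiveL _ τ b := by
  obtain ⟨hΨc, hΨ⟩ := h
  have hΨm := memLp_top_of_continuousOn_unit hΨc
  obtain ⟨ψ, hψ⟩ : ∃ ψ : Lp (Eu n →L[ℝ] Eu n) ∞ unitMeasure,
      ψ =ᵐ[unitMeasure] fun s => (linA f u x s).comp (Ψ s) := by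
    refine ⟨(ContinuousLinearMap.compL ℝ (Eu n) (Eu n) (Eu n)).holder ∞ A hΨm.toLp, ?_⟩
    filter_upwards [ContinuousLinearMap.coeFn_holder (r := ∞)
      (ContinuousLinearMap.compL ℝ (Eu n) (Eu n) (Eu n)) A hΨm.toLp, hA, hΨm.coeFn_toLp]
      with s h1 h2 h3
    rw [h1, h2, h3, ContinuousLinearMap.compL_apply]
  have hΨ' : ∀ t ∈ Icc (0 : ℝ) 1,
      Ψ t = (.id ℝ (Eu n) - primitiveL _ τ ψ) + primitiveL _ t ψ := by
    intro t ht
    rw [hΨ t ht, intervalIntegral_eq_primitiveL_sub hψ hτ ht]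
    abel
  have hprod : ∀ t ∈ Icc (0 : ℝ) 1, (ContinuousLinearMap.id ℝ (Eu n) +
      primitiveL _ t b).comp (Ψ t) = .id ℝ (Eu n) - primitiveL _ τ ψ := by
    intro t ht
    have h := bilin_primitiveL (ContinuousLinearMap.compL ℝ (Eu n) (Eu n) (Eu n)) b ψ
      (.id ℝ (Eu n)) (.id ℝ (Eu n) - primitiveL _ τ ψ) 0 ?_ ht
    · rw [← hΨ' t ht, map_zero, add_zero] at h
      exact h
    · filter_upwards [hψ, hb, hA, Lp.coeFn_zero (Eu n →L[ℝ] Eu n) ∞ unitMeasure,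
        ae_restrict_mem measurableSet_Icc] with s h1 h2 h3 h4 h5
      rw [h4, ← hΨ' s h5, h1, h2, h3]
      simp only [ContinuousLinearMap.compL_apply, ContinuousLinearMap.neg_comp,
        ContinuousLinearMap.comp_assoc, neg_add_cancel, Pi.zero_apply]
  have hτid : Ψ τ = .id ℝ (Eu n) := by
    rw [hΨ τ hτ, intervalIntegral.integral_same, add_zero]
  have e := (hprod 1 (by simp)).trans (hprod τ hτ).symm
  rwa [hτid, ContinuousLinearMap.comp_id] at e

/-- The transition matrix in terms of the fundamental solution. -/
theorem transition_eq {u : Control p} {x : Eu n} {A a b : Lp (Eu n →L[ℝ] Eu n) ∞ unitMeasure}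
    (hA : A =ᵐ[unitMeasure] linA f u x)
    (ha : a =ᵐ[unitMeasure] fun s => (A s).comp (.id ℝ (Eu n) + primitiveL _ s a))
    (hb : b =ᵐ[unitMeasure]
      fun s => -((.id ℝ (Eu n) + primitiveL (Eu n →L[ℝ] Eu n) s b).comp (A s)))
    (hab : ∀ t ∈ Icc (0 : ℝ) 1, (ContinuousLinearMap.id ℝ (Eu n) + primitiveL _ t a).comp
        (.id ℝ (Eu n) + primitiveL _ t b) = .id ℝ (Eu n))
    {τ : ℝ} (hτ : τ ∈ Icc (0 : ℝ) 1) :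
    transition f u x 1 τ = (ContinuousLinearMap.id ℝ (Eu n) + primitiveL _ 1 a).comp
      (.id ℝ (Eu n) + primitiveL _ τ b) := by
  have hspec : IsTransition f u x τ (Classical.epsilon fun Ψ => IsTransition f u x τ Ψ) :=
    Classical.epsilon_spec ⟨_, isTransition_fundamental hA ha hτ (hab τ hτ)⟩
  rw [← hspec.apply_one hA hb hτ, ← ContinuousLinearMap.comp_assoc, hab 1 (by simp),
    ContinuousLinearMap.id_comp]
  rfl

/-- The variation of constants formula. -/
theorem primitiveL_eq_linEndpoint
    (hf : ContDiff ℝ ∞ (fun z : Eu n × Eu p => f z.1 z.2))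
    (hflow : HasFlow f) {x : Eu n} {u v : Control p}
    {w : Lp (Eu n) ∞ unitMeasure} (hw : w =ᵐ[unitMeasure] fun s =>
      linA f u x s (primitiveL (Eu n) s w) + linB f u x s (v s)) :
    primitiveL (Eu n) 1 w = linEndpoint f u x v := by
  have hA := coeFn_restrictFstL_derivAlong hf hflow x u
  set A := restrictFstL (Eu n) (Eu p) (derivAlong hf (flowClass hflow x u, u))
  obtain ⟨a, b, ha, hb, hab⟩ := exists_fundamental_pair A
  have h1 : (1 : ℝ) ∈ Icc (0 : ℝ) 1 := by simp
  have hYm : MemLp (fun s => ContinuousLinearMap.id ℝ (Eu n) +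
      primitiveL (Eu n →L[ℝ] Eu n) s b) ∞ unitMeasure :=
    memLp_top_of_continuousOn_unit
      (continuous_const.add (continuous_primitiveL b)).continuousOn
  set Y := hYm.toLp
  set β := applyL unitMeasure (Eu n × Eu p) (Eu n) (derivAlong hf (flowClass hflow x u, u))
      (pairL (Eu n) (Eu p) (0, v))
  have hβ : β =ᵐ[unitMeasure] fun s => linB f u x s (v s) := by
    filter_upwards [coeFn_applyL_derivAlong hf hflow x u v 0,
      Lp.coeFn_zero (Eu n) ∞ unitMeasure] with s h2 h3
    rw [h2, h3]
    simp
  set k := applyL unitMeasure (Eu n) (Eu n) Y β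
  have hk : k =ᵐ[unitMeasure] fun s => (ContinuousLinearMap.id ℝ (Eu n) +
      primitiveL (Eu n →L[ℝ] Eu n) s b) (linB f u x s (v s)) := by
    filter_upwards [coeFn_applyL Y β, hYm.coeFn_toLp, hβ] with s h2 h3 h4
    rw [h2, h3, h4]
  -- The inverse fundamental solution is an integrating factor: the `A` terms cancel and only the
  -- input term `k` remains.
  have hY := bilin_primitiveL (ContinuousLinearMap.id ℝ (Eu n →L[ℝ] Eu n)) b w
    (.id ℝ (Eu n)) 0 k (by
      filter_upwards [hk, hb, hw, hA] with s h2 h3 h4 h5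
      rw [h2, h3, h5, zero_add]
      conv_rhs => rw [h4]
      simp only [ContinuousLinearMap.id_apply, neg_apply, ContinuousLinearMap.comp_apply,
        map_add]
      abel) h1
  rw [map_zero, zero_add, zero_add] at hY
  set Z := ContinuousLinearMap.id ℝ (Eu n) + primitiveL _ 1 a with hZ
  have hfin : primitiveL (Eu n) 1 w = Z (primitiveL (Eu n) 1 k) := by
    rw [← hY]
    exact (congrArg (fun T : Eu n →L[ℝ] Eu n => T (primitiveL (Eu n) 1 w)) (hab 1 h1)).symm
  rw [hfin, primitiveL_apply, ← Z.intervalIntegral_comp_comm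
    (Linfty.integrable k).intervalIntegrable,
    intervalIntegral_unitMeasure (by simp) h1, linEndpoint]
  refine intervalIntegral.integral_congr_ae ?_
  filter_upwards [(ae_restrict_iff' measurableSet_Icc).1 hk] with s hs hs'
  rw [uIoc_of_le zero_le_one] at hs'
  have hs1 : s ∈ Icc (0 : ℝ) 1 := ⟨hs'.1.le, hs'.2⟩
  rw [hs hs1, transition_eq hA ha hb hab hs1]
  rfl

/-- The end-point map is smooth in the control. -/
theorem contDiff_flow_one
    (hf : ContDiff ℝ ∞ (fun z : Eu n × Eu p => f z.1 z.2))
    (hflow : HasFlow f) (x : Eu n) :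
    ContDiff ℝ ∞ fun u : Control p => flow f u x 1 := by
  have h := contDiff_endpoint hf x (flowClass_eq hf hflow x)
  have e : (fun u : Control p => flow f u x 1) = fun u =>
      x + primitiveL (Eu n) 1 (velocity hf (flowClass hflow x u, u)) :=
    funext fun u => flow_eq_primitiveL hf hflow x u (by simp)
  rwa [e]

/-- The derivative of the end-point map is the linearized end-point operator. -/
theorem exists_hasFDerivAt_flow_one
    (hf : ContDiff ℝ ∞ (fun z : Eu n × Eu p => f z.1 z.2))
    (hflow : HasFlow f) (x : Eu n) (u : Control p) :
    ∃ L : Control p →L[ℝ] Eu n, HasFDerivAt (fun u : Control p => flow f u x 1) L u ∧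
      ∀ v, L v = linEndpoint f u x v := by
  have h := hasFDerivAt_endpoint hf x (flowClass_eq hf hflow x) u
  refine ⟨_, h.congr_of_eventuallyEq (Eventually.of_forall fun w =>
    flow_eq_primitiveL hf hflow x w (by simp)), fun v => ?_⟩
  have hz := fderiv_solution hf (flowClass_eq hf hflow x) u v
  set z := fderiv ℝ (flowClass hflow x) u v with hzdef
  -- Here `w = A z + B v` is the velocity of the variation `z`, and the variational equation says
  -- that `z` is its primitive.
  refine primitiveL_eq_linEndpoint (w := applyL unitMeasure (Eu n × Eu p) (Eu n)
    (derivAlong hf (flowClass hflow x u, u)) (pairL (Eu n) (Eu p) (z, v))) hf hflow ?_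
  filter_upwards [coeFn_applyL_derivAlong hf hflow x u v z, coeFn_volterra
    (applyL unitMeasure (Eu n × Eu p) (Eu n) (derivAlong hf (flowClass hflow x u, u))
      (pairL (Eu n) (Eu p) (z, v)))] with s h1 h2
  rw [← hz] at h2
  rw [h1, h2]

/-- Controllability is used only from the initial state `0`, where variation of constants has no
homogeneous term. -/
theorem linEndpoint_surjective
    (hf : ContDiff ℝ ∞ (fun z : Eu n × Eu p => f z.1 z.2))
    (hflow : HasFlow f) {x : Eu n} {u : Control p}
    (hc : LinControllable f u x) : Function.Surjective (linEndpoint f u x) := by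
  intro z₁
  obtain ⟨v, z, ⟨hzc, hz⟩, rfl⟩ := hc 0 z₁
  refine ⟨v, ?_⟩
  have hzm := memLp_top_of_continuousOn_unit hzc
  have hw := coeFn_applyL_derivAlong hf hflow x u v hzm.toLp
  set w := applyL unitMeasure (Eu n × Eu p) (Eu n) (derivAlong hf (flowClass hflow x u, u))
    (pairL (Eu n) (Eu p) (hzm.toLp, v))
  have hw' : w =ᵐ[unitMeasure] fun s => linA f u x s (z s) + linB f u x s (v s) := by
    filter_upwards [hw, hzm.coeFn_toLp] with s h1 h2
    rw [h1, h2]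
  have hzw : ∀ t ∈ Icc (0 : ℝ) 1, z t = primitiveL (Eu n) t w := by
    intro t ht
    rw [hz t ht, zero_add, primitiveL_eq ht hw']
  rw [hzw 1 (by simp)]
  refine (primitiveL_eq_linEndpoint hf hflow ?_).symm
  filter_upwards [hw', ae_restrict_mem measurableSet_Icc] with s h1 h2
  rw [h1, hzw s h2]

end Flow

/-! ### Control sets and their intersections. -/

section Memorization

variable {n p m q : ℕ} {f : Eu n → Eu p → Eu n}

theorem contDiff_output (hf : ContDiff ℝ ∞ (fun z : Eu n × Eu p => f z.1 z.2))
    (hflow : HasFlow f) (R : Eu n →L[ℝ] Eu m) (x : Eu n) :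
    ContDiff ℝ ∞ fun u : Control p => R (flow f u x 1) :=
  R.contDiff.comp (contDiff_flow_one hf hflow x)

theorem exists_hasFDerivAt_output (hf : ContDiff ℝ ∞ (fun z : Eu n × Eu p => f z.1 z.2))
    (hflow : HasFlow f) (R : Eu n →L[ℝ] Eu m) (u : Control p) (x : Eu n) :
    ∃ L : Control p →L[ℝ] Eu m, HasFDerivAt (fun u : Control p => R (flow f u x 1)) L u ∧
      ∀ v, L v = R (linEndpoint f u x v) := by
  obtain ⟨L, hL, hv⟩ := exists_hasFDerivAt_flow_one hf hflow x u
  exact ⟨R.comp L, R.hasFDerivAt.comp u hL, fun v => congrArg R (hv v)⟩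

theorem tangentAt_controlSet_subset (hf : ContDiff ℝ ∞ (fun z : Eu n × Eu p => f z.1 z.2))
    (hflow : HasFlow f) (R : Eu n →L[ℝ] Eu m) (u : Control p) (x : Eu n) (y : Eu m) :
    tangentAt (controlSet f R x y) u ⊆ linKer f R u x := by
  obtain ⟨L, hL, hv⟩ := exists_hasFDerivAt_output hf hflow R u x
  intro v hvt
  have := tangentAt_levelSet_subset hL hvt
  exact (hv v).symm.trans this

theorem controlSet_isSubmanifoldAt (hf : ContDiff ℝ ∞ (fun z : Eu n × Eu p => f z.1 z.2))
    (hflow : HasFlow f) {R : Eu n →L[ℝ] Eu m} (hR : Function.Surjective R) {u : Control p}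
    {x : Eu n} {y : Eu m} (hu : u ∈ controlSet f R x y) (hc : LinControllable f u x) :
    IsSubmanifoldAt (controlSet f R x y) u ∧
      tangentAt (controlSet f R x y) u = linKer f R u x := by
  obtain ⟨L, hL, hv⟩ := exists_hasFDerivAt_output hf hflow R u x
  have hsurj : Function.Surjective L := by
    have := hR.comp (linEndpoint_surjective hf hflow hc)
    rwa [show ⇑L = R ∘ linEndpoint f u x from funext hv]
  have hset : controlSet f R x y = {w | R (flow f w x 1) = R (flow f u x 1)} := by
    rw [show R (flow f u x 1) = y from hu]
    rfl
  rw [hset]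
  refine ⟨isSubmanifoldAt_levelSet (contDiff_output hf hflow R x) hL hsurj, ?_⟩
  rw [tangentAt_levelSet (contDiff_output hf hflow R x) hL hsurj]
  ext v
  change L v = 0 ↔ R (linEndpoint f u x v) = 0
  rw [hv]

/-- Strong memorization lets one prescribe the linearized output at one point, keeping the
outputs at the other points fixed to first order. -/
theorem exists_separating_variation (hf : ContDiff ℝ ∞ (fun z : Eu n × Eu p => f z.1 z.2))
    (hflow : HasFlow f) {R : Eu n →L[ℝ] Eu m} (hR : Function.Surjective R) {x : Fin q → Eu n}
    (hx : Function.Injective x) (hstrong : StrongMemorization f R q) (u : Control p) (i : Fin q)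
    (hc : LinControllable f u (x i)) (w : Eu m) :
    ∃ b : Control p, R (linEndpoint f u (x i) b) = w ∧
      ∀ l ≠ i, R (linEndpoint f u (x l) b) = 0 := by
  obtain ⟨z, rfl⟩ := hR w
  obtain ⟨v, rfl⟩ := linEndpoint_surjective hf hflow hc z
  -- Taking the outputs of `u` itself as targets puts `u` in all the sets, including those outside
  -- the intersection under study.
  obtain ⟨-, htrans⟩ := hstrong x (fun l => R (flow f u (x l) 1)) hx
  obtain ⟨a, ha, b, hb, hab⟩ := htrans u (mem_iInter.2 fun l => rfl) i v
  refine ⟨b, ?_, fun l hl =>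
    tangentAt_controlSet_subset hf hflow R u (x l) _ (mem_iInter₂.1 hb l hl)⟩
  obtain ⟨L, -, hL⟩ := exists_hasFDerivAt_output hf hflow R u (x i)
  have ha0 : R (linEndpoint f u (x i) a) = 0 :=
    tangentAt_controlSet_subset hf hflow R u (x i) _ ha
  rw [← hL] at ha0 ⊢
  rw [← hL, ← hab, map_add, ha0, zero_add]

/-- The intersection is one level set of the joint output map over `s`. Its derivative is onto
because the separating variations, one for each index, add up without interference. -/
theorem iInter_controlSet_isSubmanifoldAt
    (hf : ContDiff ℝ ∞ (fun z : Eu n × Eu p => f z.1 z.2))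
    (hflow : HasFlow f) {R : Eu n →L[ℝ] Eu m} (hR : Function.Surjective R) {x : Fin q → Eu n}
    {y : Fin q → Eu m} (hx : Function.Injective x) (hstrong : StrongMemorization f R q)
    (s : Set (Fin q)) {u : Control p} (hu : u ∈ ⋂ i ∈ s, controlSet f R (x i) (y i))
    (hc : ∀ i ∈ s, LinControllable f u (x i)) :
    IsSubmanifoldAt (⋂ i ∈ s, controlSet f R (x i) (y i)) u ∧
      tangentAt (⋂ i ∈ s, controlSet f R (x i) (y i)) u = ⋂ i ∈ s, linKer f R u (x i) := by
  classical
  choose L hL hLv using fun i : s => exists_hasFDerivAt_output hf hflow R u (x i)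
  set g : Control p → s → Eu m := fun w i => R (flow f w (x i) 1) with hg
  have hgs : ContDiff ℝ ∞ g := contDiff_pi.2 fun i => contDiff_output hf hflow R (x i)
  have hgd : HasFDerivAt g (ContinuousLinearMap.pi L) u := hasFDerivAt_pi.2 hL
  have hsurj : Function.Surjective (ContinuousLinearMap.pi L) := by
    intro w
    choose b hb hb0 using fun i : s =>
      exists_separating_variation hf hflow hR hx hstrong u i (hc i i.2) (w i)
    refine ⟨∑ i, b i, ?_⟩
    ext1 l
    rw [ContinuousLinearMap.pi_apply, map_sum, Finset.sum_eq_single l, hLv, hb]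
    · intro i _ hil
      rw [hLv]
      exact hb0 i l fun h => hil (Subtype.ext h).symm
    · exact fun h => absurd (Finset.mem_univ l) h
  have hset : ⋂ i ∈ s, controlSet f R (x i) (y i) = {w | g w = g u} := by
    ext w
    simp only [mem_iInter] at hu ⊢
    constructor
    · exact fun h => funext fun i => (h i i.2).trans (hu i i.2).symm
    · exact fun h i hi => (congrFun h ⟨i, hi⟩).trans (hu i hi)
  rw [hset]
  refine ⟨isSubmanifoldAt_levelSet hgs hgd hsurj, ?_⟩
  rw [tangentAt_levelSet hgs hgd hsurj]
  ext v
  simp only [mem_iInter]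
  constructor
  · exact fun h i hi => (hLv ⟨i, hi⟩ v).symm.trans (congrFun h ⟨i, hi⟩)
  · exact fun h => funext fun i => (hLv i v).trans (h i i.2)

end Memorization

end NeuralODE

theorem mainTheorem3 {n p m q : ℕ}
    (f : NeuralODE.Eu n → NeuralODE.Eu p → NeuralODE.Eu n)
    (hf : ContDiff ℝ ∞ (fun z : NeuralODE.Eu n × NeuralODE.Eu p => f z.1 z.2))
    (hflow : NeuralODE.HasFlow f)
    (R : NeuralODE.Eu n →L[ℝ] NeuralODE.Eu m) (hR : Function.Surjective R)
    (x : Fin q → NeuralODE.Eu n) (y : Fin q → NeuralODE.Eu m) (hx : Function.Injective x)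
    (hbracket : NeuralODE.FoldedBracketGenerating f q)
    (hlcp : ∀ i, NeuralODE.LCP f R (x i) (y i))
    (hstrong : NeuralODE.StrongMemorization f R q) :
    (∀ i : Fin q, ∀ u ∈ NeuralODE.controlSet f R (x i) (y i),
      NeuralODE.IsSubmanifoldAt (NeuralODE.controlSet f R (x i) (y i)) u ∧
      NeuralODE.tangentAt (NeuralODE.controlSet f R (x i) (y i)) u =
        NeuralODE.linKer f R u (x i)) ∧
    (∀ j ≤ q, ∀ u ∈ ⋂ i ∈ {i : Fin q | (i : ℕ) < j}, NeuralODE.controlSet f R (x i) (y i),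
      NeuralODE.IsSubmanifoldAt
        (⋂ i ∈ {i : Fin q | (i : ℕ) < j}, NeuralODE.controlSet f R (x i) (y i)) u ∧
      NeuralODE.tangentAt
        (⋂ i ∈ {i : Fin q | (i : ℕ) < j}, NeuralODE.controlSet f R (x i) (y i)) u =
          ⋂ i ∈ {i : Fin q | (i : ℕ) < j}, NeuralODE.linKer f R u (x i)) := by
  refine ⟨fun i u hu => NeuralODE.controlSet_isSubmanifoldAt hf hflow hR hu (hlcp i u hu),
    fun j _ u hu => ?_⟩
  exact NeuralODE.iInter_controlSet_isSubmanifoldAt hf hflow hR hx hstrong _ hu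
    fun i hi => hlcp i u (Set.mem_iInter₂.1 hu i hi)
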